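/- Let $R$ be an associative ring with unity, let "module" mean left $R$-module, and let complexes (not necessarily bounded) be written homologically, $\cdots\to X_{n+1}\to X_n\to X_{n-1}\to\cdots$ with $n\in\mathbb{Z}$. A complex $T$ is *totally $\mathcal{F}$-acyclic* if it is exact, every $T_n$ is projective, and the complex $\operatorname{Hom}_R(T,F)$ is exact for every flat module $F$. A complex $P$ is *DG-projective* if every $P_n$ is projective and $\operatorname{Hom}_R(P,E)$ is exact for every exact complex $E$. An *$\mathcal{F}$-complete resolution* of a complex $X$ is a diagram of morphisms of complexes $T\xrightarrow{\tau}P\xrightarrow{\pi}X$ in which $T$ is totally $\mathcal{F}$-acyclic, $P$ is DG-projective, $\pi$ is a quasi-isomorphism, and $\tau_i:T_i\to P_i$ is bijective for all sufficiently large $i$. The *Ding projective dimension* $\operatorname{Dpd}_R(X)\in\{-\infty\}\cup\mathbb{Z}\cup\{\infty\}$ is the infimum of the integers $n$ for which there is an $\mathcal{F}$-complete resolution $T\xrightarrow{\tau}P\xrightarrow{\pi}X$ with $\tau_i$ bijective for every $i\ge n$ (so it is $\infty$ if no such $n$ exists). Corollary. For every family $(X_i)_{i\in I}$ of complexes of $R$-modules,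 $$\operatorname{Dpd}_R\Big(\bigoplus_{i\in I}X_i\Big)=\sup\{\operatorname{Dpd}_R(X_i)\mid i\in I\},$$ the supremum being taken in $\{-\infty\}\cup\mathbb{Z}\cup\{\infty\}$ (so it is $-\infty$ if $I=\emptyset$). -/

import Mathlib

open CategoryTheory CategoryTheory.Limits
open scoped TensorProduct

universe u v

namespace DingDim

section Flat

/-!
Flatness over an arbitrary (possibly noncommutative) ring. A right `R`-module is a module over
`Rᵐᵒᵖ`, with `n · r = MulOpposite.op r • n`.
-/

variable (R : Type u) [Ring R]

/-- The subgroup of `N ⊗_ℤ M` generated by the elements `(n · r) ⊗ m - n ⊗ (r • m)`. -/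
def tensorRelations (N : Type v) (M : Type v) [AddCommGroup N] [Module Rᵐᵒᵖ N]
    [AddCommGroup M] [Module R M] : AddSubgroup (N ⊗[ℤ] M) :=
  AddSubgroup.closure
    {x | ∃ (r : R) (n : N) (m : M), x = (MulOpposite.op r • n) ⊗ₜ[ℤ] m - n ⊗ₜ[ℤ] (r • m)}

/-- The tensor product `N ⊗_R M` of a right `R`-module `N` and a left `R`-module `M`,
an abelian group. -/
abbrev RTensor (N : Type v) (M : Type v) [AddCommGroup N] [Module Rᵐᵒᵖ N]
    [AddCommGroup M] [Module R M] : Type v :=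
  (N ⊗[ℤ] M) ⧸ tensorRelations R N M

variable {R}

theorem tensorRelations_le_comap {N N' : Type v} [AddCommGroup N] [Module Rᵐᵒᵖ N]
    [AddCommGroup N'] [Module Rᵐᵒᵖ N'] (f : N →ₗ[Rᵐᵒᵖ] N')
    (M : Type v) [AddCommGroup M] [Module R M] :
    tensorRelations R N M ≤
      (tensorRelations R N' M).comap
        (f.toAddMonoidHom.toIntLinearMap.rTensor M).toAddMonoidHom := by
  refine (AddSubgroup.closure_le _).2 ?_
  rintro _ ⟨r, n, m, rfl⟩
  refine AddSubgroup.subset_closure ⟨r, f n, m, ?_⟩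
  simp

/-- The group homomorphism `f ⊗_R M : N ⊗_R M → N' ⊗_R M` induced by a homomorphism
`f : N → N'` of right `R`-modules. -/
def rTensorMap {N N' : Type v} [AddCommGroup N] [Module Rᵐᵒᵖ N]
    [AddCommGroup N'] [Module Rᵐᵒᵖ N'] (f : N →ₗ[Rᵐᵒᵖ] N')
    (M : Type v) [AddCommGroup M] [Module R M] : RTensor R N M →+ RTensor R N' M :=
  QuotientAddGroup.map _ _ (f.toAddMonoidHom.toIntLinearMap.rTensor M).toAddMonoidHom
    (tensorRelations_le_comap f M)

variable (R) in
/-- A left `R`-module `M` is flat if `- ⊗_R M` preserves injectivity of homomorphisms of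
right `R`-modules. -/
def IsFlat (M : Type v) [AddCommGroup M] [Module R M] : Prop :=
  ∀ (N N' : Type v) [AddCommGroup N] [Module Rᵐᵒᵖ N] [AddCommGroup N'] [Module Rᵐᵒᵖ N']
    (f : N →ₗ[Rᵐᵒᵖ] N'), Function.Injective f → Function.Injective (rTensorMap f M)

end Flat

section Complexes

/-!
A complex of left `R`-modules in homological notation, `⋯ → Xₙ₊₁ → Xₙ → Xₙ₋₁ → ⋯`, is a
`CochainComplex (ModuleCat R) ℤ` under the usual convention `Xₙ = X⁻ⁿ`: the module in
homological degree `n` is `X.X (-n)`.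
-/

variable {R : Type u} [Ring R]

/-- Totally `ℱ`-acyclic complexes, `ℱ` being the class of flat modules: exact complexes `T` of
projective modules such that `Hom_R(T, F)` is exact for every flat module `F`. -/
structure IsTotallyFAcyclic (T : CochainComplex (ModuleCat.{v} R) ℤ) : Prop where
  projective : ∀ n : ℤ, Module.Projective R (T.X n)
  acyclic : T.Acyclic
  hom_exact : ∀ F : ModuleCat.{v} R, IsFlat R F → ∀ n : ℤ,
    Function.Exact (fun g : T.X (n + 1) ⟶ F => T.d n (n + 1) ≫ g)
      (fun f : T.X n ⟶ F => T.d (n - 1) n ≫ f)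

/-- DG-projective complexes: complexes `P` of projective modules such that `Hom_R(P, E)` is
exact for every exact complex `E`. The last condition is `CochainComplex.IsKProjective`: every
morphism from `P` to an exact complex `E` is homotopic to zero, which (`E` ranging over all
shifts of a given exact complex) says that all homology groups of `Hom_R(P, E)` vanish. -/
structure IsDGProjective (P : CochainComplex (ModuleCat.{v} R) ℤ) : Prop where
  projective : ∀ n : ℤ, Module.Projective R (P.X n)
  isKProjective : P.IsKProjective

/-- An `ℱ`-complete resolution of `X`: morphisms of complexes `T --τ--> P --π--> X` with `T` totally
`ℱ`-acyclic, `π` a DG-projective resolution, i.e. a quasi-isomorphism with `P` DG-projective,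
and `τᵢ : Tᵢ → Pᵢ` bijective for all large homological degrees `i`. -/
structure FCompleteResolution (X : CochainComplex (ModuleCat.{v} R) ℤ) where
  T : CochainComplex (ModuleCat.{v} R) ℤ
  P : CochainComplex (ModuleCat.{v} R) ℤ
  τ : T ⟶ P
  π : P ⟶ X
  totallyFAcyclic : IsTotallyFAcyclic T
  dgProjective : IsDGProjective P
  quasiIso : QuasiIso π
  eventually_bijective : ∃ m : ℤ, ∀ i : ℤ, m ≤ i → Function.Bijective (τ.f (-i))

/-- The Ding projective dimension of `X`, in `{-∞} ∪ ℤ ∪ {∞}`: the infimum of the integers `n`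
such that there is an `ℱ`-complete resolution of `X` with `τᵢ` bijective for all homological
degrees `i ≥ n`. It is `∞` if there is no such `n`, and `-∞` if every integer is such an `n`. -/
noncomputable def dpd (X : CochainComplex (ModuleCat.{v} R) ℤ) : EInt :=
  sInf {a : EInt | ∃ n : ℤ, a = (n : EInt) ∧
    ∃ D : FCompleteResolution X, ∀ i : ℤ, n ≤ i → Function.Bijective (D.τ.f (-i))}

end Complexes

end DingDim

/-! The infimum defining `dpd` is over integers, so `dpd X ≤ n` holds exactly when `X` has an
`ℱ`-complete resolution with `τ` bijective in homological degrees at least `n`. The theorem thus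
says that, for each `n`, a coproduct has such a resolution if and only if every summand does.

From the summands to the coproduct, take coproducts of resolutions. Coproducts of modules are exact
and maps out of them are families of maps, so total `ℱ`-acyclicity, DG-projectivity and
quasi-isomorphisms all survive.

Conversely, each summand is a retract `Y` of the coproduct `X`, and the property must descend to
retracts (`HasFCompleteResolutionFrom.of_retract`). An Eilenberg swindle builds a DG-projective
resolution `Q` of `Y` out of the resolution `P` of `X`, and lifting makes `Q` a homotopy retract of
`P`. In cohomological degrees at most `a = -n`, `P` agrees with a totally `ℱ`-acyclic `T`. Hence `Q`
is exact below `a`, maps to flat modules extend there, and the cokernel `Q.opcycles a` is a summand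
of `T.opcycles a ⊞ Q.X (a + 1)`. Such summands embed in projectives, with maps to flat modules
extending and with a cokernel of the same kind (`IsDingSummand.exists_embedding`). Iterating to the
right of `a` and splicing with `Q` gives the new totally `ℱ`-acyclic complex. Its map to `Q` exists
because the terms of `Q` are projective, hence flat. -/

namespace DingDim
-- Projective modules are flat
section
variable {R : Type u} [Ring R]

/-- The map `N ⊗_ℤ M → (M →₀ N)` given by the coordinates of a linear map `s : M → (M →₀ R)`. -/
noncomputable def coordHom (N M : Type v) [AddCommGroup N] [Module Rᵐᵒᵖ N] [AddCommGroup M]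
    [Module R M] (s : M →ₗ[R] (M →₀ R)) : N ⊗[ℤ] M →ₗ[ℤ] (M →₀ N) :=
  TensorProduct.lift (AddMonoidHom.toIntLinearMap
    { toFun := fun n => AddMonoidHom.toIntLinearMap
        { toFun := fun m => (s m).mapRange (fun r => MulOpposite.op r • n) (by simp)
          map_zero' := by ext; simp
          map_add' := fun a b => by ext; simp [add_smul] }
      map_zero' := by ext; simp
      map_add' := fun a b => by ext; simp })

theorem coordHom_tmul {N M : Type v} [AddCommGroup N] [Module Rᵐᵒᵖ N] [AddCommGroup M] [Module R M]
    (s : M →ₗ[R] (M →₀ R)) (n : N) (m x : M) :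
    coordHom N M s (n ⊗ₜ m) x = MulOpposite.op (s m x) • n := by
  rfl

theorem coordHom_eq_zero {N M : Type v} [AddCommGroup N] [Module Rᵐᵒᵖ N] [AddCommGroup M]
    [Module R M] (s : M →ₗ[R] (M →₀ R)) {y : N ⊗[ℤ] M} (hy : y ∈ tensorRelations R N M) :
    coordHom N M s y = 0 := by
  induction hy using AddSubgroup.closure_induction with
  | mem x hx =>
    obtain ⟨r, n, m, rfl⟩ := hx
    ext x
    simp [coordHom_tmul, mul_smul]
  | zero => simp
  | add a b _ _ ha hb => simp [ha, hb]
  | neg a _ ha => simp [ha]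

/-- The map `(M →₀ N) → N ⊗_R M` sending `n` at `x` to `n ⊗ x`. -/
noncomputable def ofCoord (N M : Type v) [AddCommGroup N] [Module Rᵐᵒᵖ N] [AddCommGroup M]
    [Module R M] :
    (M →₀ N) →+ RTensor R N M :=
  Finsupp.liftAddHom fun x => (QuotientAddGroup.mk' (tensorRelations R N M)).comp
    ((TensorProduct.mk ℤ N M).flip x).toAddMonoidHom

theorem ofCoord_coordHom {N M : Type v} [AddCommGroup N] [Module Rᵐᵒᵖ N] [AddCommGroup M]
    [Module R M] (s : M →ₗ[R] (M →₀ R))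
    (hs : ∀ m, (s m).sum (fun x r => r • x) = m) (y : N ⊗[ℤ] M) :
    ofCoord N M (coordHom N M s y) = QuotientAddGroup.mk' (tensorRelations R N M) y := by
  induction y using TensorProduct.induction_on with
  | zero => simp
  | add a b ha hb => simp only [map_add, ha, hb]
  | tmul n m =>
    have h1 : coordHom N M s (n ⊗ₜ m) =
        (s m).mapRange (fun r => MulOpposite.op r • n) (by simp) := by
      ext x; simp [coordHom_tmul]
    rw [h1, ofCoord, Finsupp.liftAddHom_apply, Finsupp.sum_mapRange_index (by simp)]
    conv_rhs => rw [← hs m, Finsupp.sum, TensorProduct.tmul_sum, map_sum]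
    refine Finset.sum_congr rfl fun x _ => ?_
    exact (QuotientAddGroup.eq_iff_sub_mem).2 (AddSubgroup.subset_closure ⟨_, _, _, rfl⟩)

/-- A section `s` of the surjection from the free module on `M` embeds `N ⊗_R M` into `M →₀ N`,
naturally in `N`, with left inverse `ofCoord`. Injectivity of `f` can then be tested on coordinates.
-/
theorem isFlat_of_projective (M : Type v) [AddCommGroup M] [Module R M] [Module.Projective R M] :
    IsFlat R M := by
  intro N N' _ _ _ _ f hf
  obtain ⟨s, hs⟩ := Module.projective_def.1 ‹Module.Projective R M›
  have hs' : ∀ m, (s m).sum (fun x r => r • x) = m := fun m => by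
    simpa [Finsupp.linearCombination_apply] using hs m
  refine (injective_iff_map_eq_zero _).2 fun y => ?_
  obtain ⟨y, rfl⟩ := QuotientAddGroup.mk'_surjective _ y
  intro h
  have h1 : f.toAddMonoidHom.toIntLinearMap.rTensor M y ∈ tensorRelations R N' M :=
    (QuotientAddGroup.eq_zero_iff _).1 h
  have h2 := coordHom_eq_zero s h1
  have h3 : ∀ (y : N ⊗[ℤ] M) (x : M),
      coordHom N' M s (f.toAddMonoidHom.toIntLinearMap.rTensor M y) x = f (coordHom N M s y x) := by
    intro y x
    induction y using TensorProduct.induction_on with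
    | zero => simp
    | add a b ha hb => simp [ha, hb]
    | tmul n m => simp [coordHom_tmul]
  rw [← ofCoord_coordHom s hs', show coordHom N M s y = 0 from ?_, map_zero]
  ext x
  apply hf
  rw [← h3, h2]
  simp

end
end DingDim

/-! ### Exact colimits and coproducts of complexes -/

namespace CategoryTheory.ShortComplex

/-- A morphism of short complexes of functors which is objectwise a quasi-isomorphism is a
quasi-isomorphism. -/
theorem quasiIso_of_evaluation {D C : Type*} [Category* D] [Category* C] [Abelian C]
    {S₁ S₂ : ShortComplex (D ⥤ C)} (φ : S₁ ⟶ S₂)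
    (h : ∀ j, QuasiIso (((evaluation D C).obj j).mapShortComplex.map φ)) : QuasiIso φ := by
  rw [quasiIso_iff, NatTrans.isIso_iff_isIso_app]
  intro j
  have h1 := mapHomologyIso_hom_naturality φ ((evaluation D C).obj j)
  have h2 := (quasiIso_iff _).1 (h j)
  change IsIso (((evaluation D C).obj j).map (homologyMap φ))
  have h3 : ((evaluation D C).obj j).map (homologyMap φ) =
      (S₁.mapHomologyIso ((evaluation D C).obj j)).inv ≫
        homologyMap (((evaluation D C).obj j).mapShortComplex.map φ) ≫
          (S₂.mapHomologyIso ((evaluation D C).obj j)).hom := by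
    rw [Iso.eq_inv_comp]; exact h1.symm
  rw [h3]
  exact IsIso.comp_isIso' (Iso.isIso_inv _) (IsIso.comp_isIso' h2 (Iso.isIso_hom _))

end CategoryTheory.ShortComplex

namespace HomologicalComplex

section
variable {C : Type*} [Category* C] [Abelian C] {ι : Type*} {c : ComplexShape ι}
  {D : Type*} [Category* D]

/-- The differential as a natural transformation, for a functor to complexes. -/
def functorD (F : D ⥤ HomologicalComplex C c) (i j : ι) : F ⋙ eval C c i ⟶ F ⋙ eval C c j where
  app x := (F.obj x).d i j
  naturality _ _ f := (F.map f).comm i j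

/-- The short complex in degree `n` of a functor to complexes. -/
noncomputable def functorSc (F : D ⥤ HomologicalComplex C c) (n : ι) : ShortComplex (D ⥤ C) where
  X₁ := F ⋙ eval C c (c.prev n)
  X₂ := F ⋙ eval C c n
  X₃ := F ⋙ eval C c (c.next n)
  f := functorD F _ _
  g := functorD F _ _
  zero := by
    ext x
    exact (F.obj x).d_comp_d _ _ _

/-- The map on `functorSc` induced by a natural transformation. -/
noncomputable def functorScMap {F G : D ⥤ HomologicalComplex C c} (φ : F ⟶ G) (n : ι) :
    functorSc F n ⟶ functorSc G n where
  τ₁ := Functor.whiskerRight φ (eval C c (c.prev n))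
  τ₂ := Functor.whiskerRight φ (eval C c n)
  τ₃ := Functor.whiskerRight φ (eval C c (c.next n))
  comm₁₂ := by
    ext x
    exact (φ.app x).comm _ _
  comm₂₃ := by
    ext x
    exact (φ.app x).comm _ _

theorem quasiIso_functorScMap {F G : D ⥤ HomologicalComplex C c} (φ : F ⟶ G) (n : ι)
    (h : ∀ j, QuasiIso (φ.app j)) : ShortComplex.QuasiIso (functorScMap φ n) :=
  ShortComplex.quasiIso_of_evaluation _ fun j =>
    (quasiIsoAt_iff (φ.app j) n).1 inferInstance

variable [HasColimitsOfShape D C]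

theorem preservesColimitIso_inv_d (F : D ⥤ HomologicalComplex C c) (i j : ι) :
    (preservesColimitIso (eval C c i) F).inv ≫ (colimit F).d i j =
      colim.map (functorD F i j) ≫ (preservesColimitIso (eval C c j) F).inv := by
  apply colimit.hom_ext
  intro x
  have h1 := ι_preservesColimitIso_inv_assoc (eval C c i) F x ((colimit F).d i j)
  have h2 := ι_preservesColimitIso_inv (eval C c j) F x
  have h3 := ι_colimMap_assoc (functorD F i j) x (preservesColimitIso (eval C c j) F).inv
  refine h1.trans (Eq.trans ?_ h3.symm)
  rw [h2]
  exact (colimit.ι F x).comm i j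

theorem preservesColimitIso_inv_naturality {F G : D ⥤ HomologicalComplex C c} (φ : F ⟶ G) (i : ι) :
    (preservesColimitIso (eval C c i) F).inv ≫ (colimMap φ).f i =
      colim.map (Functor.whiskerRight φ (eval C c i)) ≫
        (preservesColimitIso (eval C c i) G).inv := by
  apply colimit.hom_ext
  intro x
  have h1 := ι_preservesColimitIso_inv_assoc (eval C c i) F x ((colimMap φ).f i)
  have h2 := ι_preservesColimitIso_inv (eval C c i) G x
  have h3 := ι_colimMap_assoc (Functor.whiskerRight φ (eval C c i)) x
    (preservesColimitIso (eval C c i) G).inv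
  refine h1.trans (Eq.trans ?_ h3.symm)
  rw [h2]
  exact congrArg (fun t => Hom.f t i) (ι_colimMap φ x)

/-- The short complex of a colimit of complexes is the colimit of the short complexes. -/
noncomputable def colimitScIso (F : D ⥤ HomologicalComplex C c) (n : ι) :
    (functorSc F n).map colim ≅ (colimit F).sc n :=
  ShortComplex.isoMk (preservesColimitIso (eval C c (c.prev n)) F).symm
    (preservesColimitIso (eval C c n) F).symm
    (preservesColimitIso (eval C c (c.next n)) F).symm
    (preservesColimitIso_inv_d F _ _) (preservesColimitIso_inv_d F _ _)

theorem quasiIso_colimMap [HasExactColimitsOfShape D C]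
    {F G : D ⥤ HomologicalComplex C c} (φ : F ⟶ G)
    (h : ∀ j, QuasiIso (φ.app j)) : QuasiIso (colimMap φ) where
  quasiIsoAt n := by
    rw [quasiIsoAt_iff]
    have := quasiIso_functorScMap φ n h
    refine (ShortComplex.quasiIso_iff_of_arrow_mk_iso
      ((colim (J := D) (C := C)).mapShortComplex.map (functorScMap φ n)) _
      (Arrow.isoMk (colimitScIso F n) (colimitScIso G n) ?_)).1 inferInstance
    refine ShortComplex.hom_ext _ _ ?_ ?_ ?_
    all_goals exact preservesColimitIso_inv_naturality φ _

end

section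

variable {C : Type*} [Category* C] [Abelian C] {ι : Type*} {c : ComplexShape ι} {J : Type*}
  [HasCoproductsOfShape J C]

theorem quasiIso_sigmaMap [HasExactColimitsOfShape (Discrete J) C]
    {K L : J → HomologicalComplex C c} (φ : ∀ j, K j ⟶ L j)
    (h : ∀ j, QuasiIso (φ j)) : QuasiIso (Limits.Sigma.map φ) :=
  quasiIso_colimMap _ fun j => h j.as

/-- A complex is acyclic exactly when its zero endomorphism is a quasi-isomorphism, and coproducts
preserve quasi-isomorphisms. -/
theorem acyclic_sigma [HasExactColimitsOfShape (Discrete J) C]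
    {K : J → HomologicalComplex C c} (h : ∀ j, (K j).Acyclic) : (∐ K).Acyclic := by
  have h1 : QuasiIso (Limits.Sigma.map fun j => (0 : K j ⟶ K j)) :=
    quasiIso_sigmaMap _ fun j => ⟨fun n => (quasiIsoAt_iff_exactAt _ _ (h j n)).2 (h j n)⟩
  have h2 : (Limits.Sigma.map fun j => (0 : K j ⟶ K j)) = 0 := by ext j; simp
  intro n
  rw [h2] at h1
  have h3 := (quasiIsoAt_iff_isIso_homologyMap _ _).1 (h1.quasiIsoAt n)
  rw [homologyMap_zero, isIsoZero_iff_source_target_isZero] at h3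
  exact (exactAt_iff_isZero_homology _ _).2 h3.1

/-- The terms of a coproduct of complexes are coproducts. -/
noncomputable def sigmaXIsColimit (K : J → HomologicalComplex C c) (n : ι) :
    IsColimit (Cofan.mk ((∐ K).X n) fun j => (Sigma.ι K j).f n) :=
  isColimitCofanMkObjOfIsColimit (eval C c n) K _ (coproductIsCoproduct K)

theorem sigmaX_hom_ext {K : J → HomologicalComplex C c} {n : ι} {A : C} {f g : (∐ K).X n ⟶ A}
    (h : ∀ j, (Sigma.ι K j).f n ≫ f = (Sigma.ι K j).f n ≫ g) : f = g :=
  Cofan.IsColimit.hom_ext (sigmaXIsColimit K n) _ _ h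

/-- A morphism from a term of a coproduct of complexes. -/
noncomputable def sigmaXDesc {K : J → HomologicalComplex C c} {n : ι} {A : C}
    (f : ∀ j, (K j).X n ⟶ A) : (∐ K).X n ⟶ A :=
  Cofan.IsColimit.desc (sigmaXIsColimit K n) f

@[simp]
theorem ι_sigmaXDesc {K : J → HomologicalComplex C c} {n : ι} {A : C}
    (f : ∀ j, (K j).X n ⟶ A) (j : J) : (Sigma.ι K j).f n ≫ sigmaXDesc f = f j :=
  Cofan.IsColimit.fac (sigmaXIsColimit K n) f j

@[simp]
theorem ι_sigmaXDesc_assoc {K : J → HomologicalComplex C c} {n : ι} {A B : C}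
    (f : ∀ j, (K j).X n ⟶ A) (j : J) (g : A ⟶ B) :
    (Sigma.ι K j).f n ≫ sigmaXDesc f ≫ g = f j ≫ g := by
  rw [← Category.assoc, ι_sigmaXDesc]

theorem projective_sigma_X {K : J → HomologicalComplex C c} {n : ι}
    (h : ∀ j, Projective ((K j).X n)) : Projective ((∐ K).X n) where
  factors {E A} f e _ := by
    refine ⟨sigmaXDesc fun j => Projective.factorThru ((Sigma.ι K j).f n ≫ f) e, ?_⟩
    apply sigmaX_hom_ext
    simp

theorem isIso_sigmaMap_f {K L : J → HomologicalComplex C c} (φ : ∀ j, K j ⟶ L j) (n : ι)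
    (h : ∀ j, IsIso ((φ j).f n)) : IsIso ((Limits.Sigma.map φ).f n) := by
  have h1 : ∀ j, (Sigma.ι K j).f n ≫ (Limits.Sigma.map φ).f n = (φ j).f n ≫ (Sigma.ι L j).f n :=
    fun j => by simp only [← comp_f, Sigma.ι_map]
  refine ⟨sigmaXDesc fun j => inv ((φ j).f n) ≫ (Sigma.ι K j).f n, ?_, ?_⟩
  · apply sigmaX_hom_ext
    intro j
    rw [reassoc_of% h1 j]
    simp
  · apply sigmaX_hom_ext
    intro j
    simp [h1 j]

/-- Homotopies from the components of a coproduct give a homotopy from the coproduct. -/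
noncomputable def sigmaHomotopy {K : J → HomologicalComplex C c} {L : HomologicalComplex C c}
    {f g : ∐ K ⟶ L} (h : ∀ j, Homotopy (Sigma.ι K j ≫ f) (Sigma.ι K j ≫ g)) : Homotopy f g where
  hom i j := sigmaXDesc fun k => (h k).hom i j
  zero i j hij := by
    apply sigmaX_hom_ext
    intro k
    simp [(h k).zero i j hij]
  comm i := by
    apply sigmaX_hom_ext
    intro k
    have h1 := (h k).comm i
    simp only [comp_f] at h1
    rw [h1]
    simp only [Preadditive.comp_add, ← dNext_comp_left, ← prevD_comp_left, ι_sigmaXDesc]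

end
end HomologicalComplex

/-! ### K-projective complexes and mapping cones -/

namespace CochainComplex

variable {C : Type*} [Category* C] [Abelian C]

theorem isKProjective_sigma {J : Type*} [HasCoproductsOfShape J C] (K : J → CochainComplex C ℤ)
    (h : ∀ j, (K j).IsKProjective) : (∐ K).IsKProjective where
  nonempty_homotopy_zero f hL := by
    refine ⟨HomologicalComplex.sigmaHomotopy fun j =>
      (IsKProjective.homotopyZero (Sigma.ι K j ≫ f) hL).trans (Homotopy.ofEq ?_)⟩
    rw [comp_zero]

/-- K-projectives are the left orthogonal of the acyclic complexes in the homotopy category, a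
triangulated subcategory. -/
theorem isKProjective_mappingCone {K L : CochainComplex C ℤ} (f : K ⟶ L) [K.IsKProjective]
    [L.IsKProjective] : (mappingCone f).IsKProjective := by
  rw [isKProjective_iff_leftOrthogonal]
  exact ObjectProperty.ext_of_isTriangulatedClosed₃ _ _
    (HomotopyCategory.mappingCone_triangleh_distinguished f)
    (IsKProjective.leftOrthogonal K) (IsKProjective.leftOrthogonal L)

theorem projective_mappingCone_X {K L : CochainComplex C ℤ} (f : K ⟶ L)
    (hK : ∀ n, Projective (K.X n)) (hL : ∀ n, Projective (L.X n)) (n : ℤ) :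
    Projective ((mappingCone f).X n) := by
  have := hK (n + 1)
  have := hL n
  exact Projective.of_iso
    (HomologicalComplex.homotopyCofiber.XIsoBiprod f n (n + 1) rfl).symm inferInstance

open DerivedCategory in
attribute [local instance] HasDerivedCategory.standard in
/-- Lifting a morphism along a quasi-isomorphism, up to homotopy, from a K-projective complex. -/
theorem IsKProjective.exists_lift {K L M : CochainComplex C ℤ} [K.IsKProjective] (π : L ⟶ M)
    [QuasiIso π] (f : K ⟶ M) : ∃ g : K ⟶ L, Nonempty (Homotopy (g ≫ π) f) := by
  -- Maps out of a K-projective complex are the same in the homotopy and derived categories, and `π`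
  -- is invertible in the latter.
  obtain ⟨g, hg⟩ := (Qh_map_bijective K ((HomotopyCategory.quotient _ _).obj L)).surjective
    ((quotientCompQhIso C).hom.app K ≫ Q.map f ≫ inv (Q.map π) ≫
      (quotientCompQhIso C).inv.app L)
  obtain ⟨g, rfl⟩ := (HomotopyCategory.quotient _ _).map_surjective g
  refine ⟨g, ⟨HomotopyCategory.homotopyOfEq _ _ ?_⟩⟩
  apply (Qh_map_bijective K _).injective
  rw [Functor.map_comp, Functor.map_comp, hg]
  simp only [Category.assoc, ← quotientCompQhIso_inv_naturality π, IsIso.inv_hom_id_assoc]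
  rw [quotientCompQhIso_inv_naturality f, Iso.hom_inv_id_app_assoc]

open DerivedCategory in
attribute [local instance] HasDerivedCategory.standard in
theorem IsKProjective.nonempty_homotopy {K L M : CochainComplex C ℤ} [K.IsKProjective] (π : L ⟶ M)
    [QuasiIso π] (f g : K ⟶ L) (h : Homotopy (f ≫ π) (g ≫ π)) : Nonempty (Homotopy f g) := by
  refine ⟨HomotopyCategory.homotopyOfEq _ _ ?_⟩
  apply (Qh_map_bijective K _).injective
  have h1 := Q_map_eq_of_homotopy _ h
  simp only [Functor.map_comp] at h1
  rw [cancel_mono] at h1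
  rw [← cancel_mono ((quotientCompQhIso C).hom.app L), quotientCompQhIso_hom_naturality,
    quotientCompQhIso_hom_naturality, h1]

open DerivedCategory in
attribute [local instance] HasDerivedCategory.standard in
theorem quasiIso_mappingCone_mapOfHomotopy {K₁ L₁ K₂ L₂ : CochainComplex C ℤ} {φ₁ : K₁ ⟶ L₁}
    {φ₂ : K₂ ⟶ L₂} {a : K₁ ⟶ K₂} {b : L₁ ⟶ L₂} (H : Homotopy (φ₁ ≫ b) (a ≫ φ₂))
    (ha : QuasiIso a) (hb : QuasiIso b) : QuasiIso (mappingCone.mapOfHomotopy H) := by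
  have key : ∀ {K L : CochainComplex C ℤ} (f : K ⟶ L), QuasiIso f ↔
      IsIso (Qh.map ((HomotopyCategory.quotient _ _).map f)) := fun {K L} f => by
    rw [← isIso_Q_map_iff_quasiIso]
    exact (NatIso.isIso_map_iff (quotientCompQhIso C) f).symm
  rw [key] at ha hb ⊢
  exact Pretriangulated.isIso₃_of_isIso₁₂
    (Qh.mapTriangle.map (mappingCone.trianglehMapOfHomotopy H))
    (Qh.map_distinguished _ (HomotopyCategory.mappingCone_triangleh_distinguished φ₁))
    (Qh.map_distinguished _ (HomotopyCategory.mappingCone_triangleh_distinguished φ₂))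
    ha hb

end CochainComplex

/-! ### Eilenberg swindle -/

section

variable {C : Type*} [Category* C] [Preadditive C] [HasCoproductsOfShape ℕ C]

/-- Eilenberg swindle: a retract `Y` of `X` is a split cokernel of an endomorphism of a countable
coproduct of copies of `X`. -/
theorem CategoryTheory.Retract.exists_splitting {Y X : C} (e : Retract Y X) :
    ∃ (f : (∐ fun _ : ℕ => X) ⟶ ∐ fun _ : ℕ => X) (g : (∐ fun _ : ℕ => X) ⟶ Y)
      (w : f ≫ g = 0), Nonempty (ShortComplex.mk f g w).Splitting := by
  let q : X ⟶ X := e.r ≫ e.i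
  have hr : q ≫ e.r = e.r := by simp [q]
  have hq : q ≫ q = q := by simp [q]
  -- Writing `X` as `Y ⊕ Y'`, `f` fixes every copy of `Y'` and shifts each copy of `Y` one place up,
  -- so it misses only the copy of `Y` at index 0. The retraction `r` shifts back.
  let f : (∐ fun _ : ℕ => X) ⟶ ∐ fun _ : ℕ => X :=
    Limits.Sigma.desc fun k =>
      (𝟙 X - q) ≫ Sigma.ι (fun _ : ℕ => X) k + q ≫ Sigma.ι (fun _ : ℕ => X) (k + 1)
  let g : (∐ fun _ : ℕ => X) ⟶ Y := Limits.Sigma.desc fun k => if k = 0 then e.r else 0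
  let r : (∐ fun _ : ℕ => X) ⟶ ∐ fun _ : ℕ => X := Limits.Sigma.desc fun k =>
    (𝟙 X - q) ≫ Sigma.ι (fun _ : ℕ => X) k +
      if k = 0 then 0 else q ≫ Sigma.ι (fun _ : ℕ => X) (k - 1)
  let s : Y ⟶ ∐ fun _ : ℕ => X := e.i ≫ Sigma.ι (fun _ : ℕ => X) 0
  have w : f ≫ g = 0 := by
    ext k
    by_cases hk : k = 0 <;> simp [f, g, hk, hr]
  refine ⟨f, g, w, ⟨{ r := r, s := s, f_r := ?_, s_g := ?_, id := ?_ }⟩⟩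
  · ext k
    by_cases hk : k = 0 <;> simp [f, r, hk, reassoc_of% hq]
  · simp [s, g]
  · ext k
    by_cases hk : k = 0
    · simp [f, r, s, g, hk, q]
    · obtain ⟨k, rfl⟩ := Nat.exists_eq_succ_of_ne_zero hk
      simp [f, r, s, g, reassoc_of% hq]

end

/-! ### DG-projective and totally `ℱ`-acyclic complexes under coproducts and retracts -/

namespace DingDim

variable {R : Type u} [Ring R]

instance (J : Type v) : HasExactColimitsOfShape (Discrete J) (ModuleCat.{v} R) :=
  HasExactColimitsOfShape.domain_of_functor (Discrete J) (forget₂ (ModuleCat R) AddCommGrpCat)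

instance : HasExactColimitsOfShape (Discrete ℕ) (ModuleCat.{v} R) :=
  have : HasCoproducts.{0} AddCommGrpCat.{v} := hasCoproducts_shrink.{0, v}
  have : AB4OfSize.{0} AddCommGrpCat.{v} := AB4OfSize_shrink.{0, v} _
  HasExactColimitsOfShape.domain_of_functor (Discrete ℕ) (forget₂ (ModuleCat R) AddCommGrpCat)

section
variable [Small.{v} R]

theorem IsDGProjective.projective_X {P : CochainComplex (ModuleCat.{v} R) ℤ}
    (h : IsDGProjective P) (n : ℤ) : Projective (P.X n) :=
  (IsProjective.iff_projective (P.X n)).1 (h.projective n)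

theorem isDGProjective_of_projective {P : CochainComplex (ModuleCat.{v} R) ℤ}
    (h : ∀ n, Projective (P.X n)) (h' : P.IsKProjective) : IsDGProjective P :=
  ⟨fun n => (IsProjective.iff_projective (P.X n)).2 (h n), h'⟩

theorem isFlat_of_categoryProjective (M : ModuleCat.{v} R) [h : Projective M] : IsFlat R M :=
  have := (IsProjective.iff_projective M).2 h
  isFlat_of_projective M

theorem IsDGProjective.sigma {J : Type*} [HasCoproductsOfShape J (ModuleCat.{v} R)]
    {P : J → CochainComplex (ModuleCat.{v} R) ℤ} (h : ∀ j, IsDGProjective (P j)) :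
    IsDGProjective (∐ P) :=
  isDGProjective_of_projective
    (fun n => HomologicalComplex.projective_sigma_X fun j => (h j).projective_X n)
    (CochainComplex.isKProjective_sigma P fun j => (h j).isKProjective)

/-- A retract of a complex with a DG-projective resolution has a DG-projective resolution. -/
theorem exists_dgProjective_of_retract {X Y P : CochainComplex (ModuleCat.{v} R) ℤ}
    (e : Retract Y X) (hP : IsDGProjective P) (π : P ⟶ X) (hπ : QuasiIso π) :
    ∃ (Q : CochainComplex (ModuleCat.{v} R) ℤ) (π' : Q ⟶ Y), IsDGProjective Q ∧ QuasiIso π' := by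
  obtain ⟨f, g, w, ⟨σ⟩⟩ := e.exists_splitting
  have hPN : IsDGProjective (∐ fun _ : ℕ => P) := IsDGProjective.sigma fun _ => hP
  have := hPN.isKProjective
  have hπN : QuasiIso (Limits.Sigma.map fun _ : ℕ => π) :=
    HomologicalComplex.quasiIso_sigmaMap _ fun _ => hπ
  -- The swindle endomorphism `f` lifts up to homotopy to `j` on copies of `P`; the cone of `j` then
  -- resolves the cokernel `Y` of `f`.
  obtain ⟨j, ⟨H⟩⟩ := CochainComplex.IsKProjective.exists_lift
    (Limits.Sigma.map fun _ : ℕ => π) (Limits.Sigma.map (fun _ : ℕ => π) ≫ f)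
  have h1 := CochainComplex.quasiIso_mappingCone_mapOfHomotopy H hπN hπN
  have h2 := CochainComplex.mappingCone.quasiIso_descShortComplex σ.shortExact
  exact ⟨CochainComplex.mappingCone j, CochainComplex.mappingCone.mapOfHomotopy H ≫
    CochainComplex.mappingCone.descShortComplex (ShortComplex.mk f g w),
    isDGProjective_of_projective
      (CochainComplex.projective_mappingCone_X j hPN.projective_X hPN.projective_X)
      (CochainComplex.isKProjective_mappingCone j), quasiIso_comp _ _⟩

end

theorem IsTotallyFAcyclic.exists_extension {T : CochainComplex (ModuleCat.{v} R) ℤ}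
    (h : IsTotallyFAcyclic T) {F : ModuleCat.{v} R} (hF : IsFlat R F) {i j k : ℤ} (hij : i + 1 = j)
    (hjk : j + 1 = k) (f : T.X j ⟶ F) (hf : T.d i j ≫ f = 0) :
    ∃ g : T.X k ⟶ F, T.d j k ≫ g = f := by
  obtain rfl : i = j - 1 := by lia
  subst hjk
  exact (h.hom_exact F hF j f).1 hf

section
variable [Small.{v} R]

theorem isTotallyFAcyclic_of_exists_extension {T : CochainComplex (ModuleCat.{v} R) ℤ}
    (h₁ : ∀ n, Projective (T.X n)) (h₂ : T.Acyclic)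
    (h₃ : ∀ (F : ModuleCat.{v} R), IsFlat R F → ∀ (i j k : ℤ), i + 1 = j → j + 1 = k →
      ∀ f : T.X j ⟶ F, T.d i j ≫ f = 0 → ∃ g : T.X k ⟶ F, T.d j k ≫ g = f) :
    IsTotallyFAcyclic T where
  projective n := (IsProjective.iff_projective (T.X n)).2 (h₁ n)
  acyclic := h₂
  hom_exact F hF n f := by
    refine ⟨fun hf => h₃ F hF (n - 1) n (n + 1) (by lia) rfl f hf, ?_⟩
    rintro ⟨g, rfl⟩
    simp

theorem IsTotallyFAcyclic.projective_X {T : CochainComplex (ModuleCat.{v} R) ℤ}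
    (h : IsTotallyFAcyclic T) (n : ℤ) : Projective (T.X n) :=
  (IsProjective.iff_projective (T.X n)).1 (h.projective n)

theorem IsTotallyFAcyclic.sigma {J : Type*} [HasCoproductsOfShape J (ModuleCat.{v} R)]
    [HasExactColimitsOfShape (Discrete J) (ModuleCat.{v} R)]
    {T : J → CochainComplex (ModuleCat.{v} R) ℤ} (h : ∀ j, IsTotallyFAcyclic (T j)) :
    IsTotallyFAcyclic (∐ T) := by
  refine isTotallyFAcyclic_of_exists_extension
    (fun n => HomologicalComplex.projective_sigma_X fun j => (h j).projective_X n)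
    (HomologicalComplex.acyclic_sigma fun j => (h j).acyclic) ?_
  intro F hF i j k hij hjk f hf
  have h1 : ∀ x, ∃ g : (T x).X k ⟶ F, (T x).d j k ≫ g = (Sigma.ι T x).f j ≫ f := fun x =>
    (h x).exists_extension hF hij hjk _ (by
      rw [← HomologicalComplex.Hom.comm_assoc, hf, comp_zero])
  choose g hg using h1
  refine ⟨HomologicalComplex.sigmaXDesc g, HomologicalComplex.sigmaX_hom_ext fun x => ?_⟩
  rw [HomologicalComplex.Hom.comm_assoc, HomologicalComplex.ι_sigmaXDesc, hg]

/-! ### Summands of cokernels and their embeddings -/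

/-- Direct summands of `U ⊕ C` for `U` projective and `C` a cokernel in a totally `ℱ`-acyclic
complex. -/
def IsDingSummand (A : ModuleCat.{v} R) : Prop :=
  ∃ (T : CochainComplex (ModuleCat.{v} R) ℤ) (m : ℤ) (U : ModuleCat.{v} R),
    IsTotallyFAcyclic T ∧ Projective U ∧ Nonempty (Retract A (T.opcycles m ⊞ U))

theorem mono_fromOpcycles {C : Type*} [Category* C] [Abelian C] (K : CochainComplex C ℤ) (m : ℤ)
    (h : K.ExactAt m) : Mono (K.fromOpcycles m (m + 1)) := by
  have h1 := (K.exactAt_iff' (m - 1) m (m + 1) (by simp) (by simp)).1 h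
  have h2 := h1.mono_fromOpcycles
  rw [← HomologicalComplex.opcyclesIsoSc'_inv_fromOpcycles K (m - 1) m (m + 1) (by simp)
    (by simp)] at h2
  exact (mono_comp_iff_of_isIso _ _).1 h2

/-- All morphisms to flat modules extend along `κ`. -/
def FlatExtending {A P : ModuleCat.{v} R} (κ : A ⟶ P) : Prop :=
  ∀ F : ModuleCat.{v} R, IsFlat R F → ∀ g : A ⟶ F, ∃ g' : P ⟶ F, κ ≫ g' = g

/-- This is the inductive step to the right: since the cokernel has the same type, the embedding can
be repeated indefinitely. -/
theorem IsDingSummand.exists_embedding {A : ModuleCat.{v} R} (hA : IsDingSummand A) :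
    ∃ (W : ModuleCat.{v} R) (κ : A ⟶ W), Projective W ∧ Mono κ ∧ FlatExtending κ ∧
      IsDingSummand (cokernel κ) := by
  obtain ⟨T, m, U, hT, hU, ⟨ρ⟩⟩ := hA
  have hTm := hT.projective_X (m + 1)
  have := mono_fromOpcycles T m (hT.acyclic m)
  set k := T.fromOpcycles m (m + 1) with hk
  let K : T.opcycles m ⊞ U ⟶ T.X (m + 1) ⊞ U := biprod.map k (𝟙 U)
  have hKm : Mono K := by dsimp [K]; infer_instance
  have hK : FlatExtending K := by
    intro F hF g
    obtain ⟨g', hg'⟩ := hT.exists_extension hF (sub_add_cancel m 1) rfl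
      (T.pOpcycles m ≫ biprod.inl ≫ g) (by simp)
    refine ⟨biprod.desc g' (biprod.inr ≫ g), ?_⟩
    rw [← T.p_fromOpcycles, Category.assoc, cancel_epi] at hg'
    refine biprod.hom_ext' _ _ ?_ ?_
    · simp [K, hk, hg']
    · simp [K]
  let κ : A ⟶ T.X (m + 1) ⊞ U := ρ.i ≫ K
  -- The target is itself flat, so the projection onto the summand `A` extends along `K` to an
  -- endomorphism `e` of it, which fixes the image of `κ`.
  obtain ⟨e, he⟩ := hK _ (isFlat_of_categoryProjective (T.X (m + 1) ⊞ U)) (ρ.r ≫ κ)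
  have hkp : k ≫ T.pOpcycles (m + 1) = 0 := by
    rw [← cancel_epi (T.pOpcycles m), hk, T.p_fromOpcycles_assoc, T.d_pOpcycles, comp_zero]
  have hKe : K ≫ e ≫ cokernel.π κ = 0 := by
    rw [reassoc_of% he, cokernel.condition, comp_zero]
  have hinr : (biprod.inr : U ⟶ T.X (m + 1) ⊞ U) = biprod.inr ≫ K := by simp [K]
  have hkin : k ≫ (biprod.inl : T.X (m + 1) ⟶ T.X (m + 1) ⊞ U) = biprod.inl ≫ K := by simp [K]
  have hκe : κ ≫ e = κ := by simp [κ, he]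
  refine ⟨_, κ, inferInstance, ?_, ?_, T, m + 1, T.X (m + 1) ⊞ U, hT, inferInstance,
    ⟨{ i := ?_, r := ?_, retract := ?_ }⟩⟩
  · have : Mono ρ.i := (inferInstance : IsSplitMono ρ.i).mono
    exact mono_comp _ _
  · intro F hF g
    obtain ⟨g', hg'⟩ := hK F hF (ρ.r ≫ g)
    exact ⟨g', by simp [κ, hg']⟩
  -- The splitting comes from `1 = e + (1 - e)`: modulo the image of `κ`, `e` kills the image of `K`
  -- and so factors through `T.opcycles (m + 1)`, while `1 - e` vanishes on the image of `κ`.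
  · exact cokernel.desc κ (biprod.lift (biprod.fst ≫ T.pOpcycles (m + 1)) (𝟙 _ - e)) (by
      refine biprod.hom_ext _ _ ?_ ?_
      · simp [κ, K, hkp]
      · simp [hκe])
  · exact biprod.desc (T.descOpcycles (biprod.inl ≫ e ≫ cokernel.π κ) m (by simp) (by
      rw [← T.p_fromOpcycles, Category.assoc, reassoc_of% hkin, hKe, comp_zero, comp_zero]))
      (cokernel.π κ)
  · rw [← cancel_epi (cokernel.π κ), cokernel.π_desc_assoc, biprod.lift_desc, Category.assoc,
      T.p_descOpcycles, Preadditive.sub_comp, Category.id_comp, Category.comp_id]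
    have h1 : biprod.fst ≫ biprod.inl ≫ e ≫ cokernel.π κ = e ≫ cokernel.π κ := by
      refine biprod.hom_ext' _ _ (by simp) ?_
      rw [biprod.inr_fst_assoc, zero_comp, hinr, Category.assoc, hKe, comp_zero]
    rw [h1]
    abel

end
end DingDim

/-! ### Transfer along a homotopy retract -/

namespace DingDim

variable {R : Type u} [Ring R]

section Comparison

variable {T P Q : CochainComplex (ModuleCat.{v} R) ℤ} {τ : T ⟶ P} {a : ℤ} {s : Q ⟶ P} {r : P ⟶ Q}

theorem exactAt_of_retract (hT : T.Acyclic) (hτ : ∀ j ≤ a, IsIso (τ.f j))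
    (h : Homotopy (s ≫ r) (𝟙 Q)) (j : ℤ) (hj : j < a) : Q.ExactAt j := by
  have hP : P.ExactAt j := by
    have e : ∀ i ≤ a, ∃ e : T.X i ≅ P.X i, e.hom = τ.f i := fun i hi =>
      have := hτ i hi
      ⟨asIso (τ.f i), rfl⟩
    obtain ⟨e₁, h₁⟩ := e (j - 1) (by lia)
    obtain ⟨e₂, h₂⟩ := e j (by lia)
    obtain ⟨e₃, h₃⟩ := e (j + 1) (by lia)
    rw [P.exactAt_iff' (j - 1) j (j + 1) (by simp) (by simp)]
    refine (ShortComplex.exact_iff_of_iso (ShortComplex.isoMk e₁ e₂ e₃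
      (by rw [h₁, h₂]; exact τ.comm _ _) (by rw [h₂, h₃]; exact τ.comm _ _))).1
      ((T.exactAt_iff' (j - 1) j (j + 1) (by simp) (by simp)).1 (hT j))
  rw [HomologicalComplex.exactAt_iff_isZero_homology] at hP ⊢
  rw [IsZero.iff_id_eq_zero, ← HomologicalComplex.homologyMap_id, ← h.homologyMap_eq,
    HomologicalComplex.homologyMap_comp, hP.eq_of_tgt (HomologicalComplex.homologyMap s j) 0,
    zero_comp]

theorem exists_extension_of_retract (hT : IsTotallyFAcyclic T) (hτ : ∀ j ≤ a, IsIso (τ.f j))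
    (h : Homotopy (s ≫ r) (𝟙 Q)) {F : ModuleCat.{v} R} (hF : IsFlat R F) {i j k : ℤ}
    (hij : i + 1 = j) (hjk : j + 1 = k) (hj : k ≤ a) (f : Q.X j ⟶ F) (hf : Q.d i j ≫ f = 0) :
    ∃ g : Q.X k ⟶ F, Q.d j k ≫ g = f := by
  have := hτ k hj
  obtain ⟨g, hg⟩ := hT.exists_extension hF hij hjk (τ.f j ≫ r.f j ≫ f) (by
    simp [← τ.comm_assoc, ← r.comm_assoc, hf])
  have := hτ j (by lia)
  have h1 : P.d j k ≫ inv (τ.f k) ≫ g = r.f j ≫ f := by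
    rw [← cancel_epi (τ.f j), τ.comm_assoc, IsIso.hom_inv_id_assoc, hg]
  have h2 := h.comm j
  rw [dNext_eq h.hom (show (ComplexShape.up ℤ).Rel j k from hjk),
    prevD_eq h.hom (show (ComplexShape.up ℤ).Rel i j from hij)] at h2
  -- The transported extension restricts to `s ≫ r ≫ f`, which differs from `f` by `d ≫ h ≫ f`; the
  -- second term corrects this.
  refine ⟨s.f k ≫ inv (τ.f k) ≫ g - h.hom k j ≫ f, ?_⟩
  have h3 := congrArg (· ≫ f) h2
  simp only [HomologicalComplex.comp_f, Preadditive.add_comp, Category.assoc, hf, comp_zero,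
    HomologicalComplex.id_f, Category.id_comp, add_zero] at h3
  rw [Preadditive.comp_sub, ← s.comm_assoc, h1, h3]
  abel

/-- On `Q.opcycles a` the identity is `s ≫ r` minus the homotopy term through `Q.X (a + 1)`; the
other homotopy term ends in a boundary and dies. This explains the extra projective summand. -/
theorem isDingSummand_of_retract (hT : IsTotallyFAcyclic T) (hQ : Projective (Q.X (a + 1)))
    (hτ : ∀ j ≤ a, IsIso (τ.f j)) (h : Homotopy (s ≫ r) (𝟙 Q)) :
    IsDingSummand (Q.opcycles a) := by
  have := hτ (a - 1) (by lia)
  have := hτ a le_rfl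
  have hinv : P.d (a - 1) a ≫ inv (τ.f a) = inv (τ.f (a - 1)) ≫ T.d (a - 1) a := by
    rw [IsIso.comp_inv_eq, Category.assoc, ← τ.comm, IsIso.inv_hom_id_assoc]
  have h2 := h.comm a
  rw [dNext_eq h.hom (show (ComplexShape.up ℤ).Rel a (a + 1) from rfl),
    prevD_eq h.hom (show (ComplexShape.up ℤ).Rel (a - 1) a by simp)] at h2
  have h3 := congrArg (· ≫ Q.pOpcycles a) h2
  simp only [HomologicalComplex.comp_f, Preadditive.add_comp, Category.assoc,
    HomologicalComplex.d_pOpcycles, comp_zero,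
    HomologicalComplex.id_f, Category.id_comp, add_zero] at h3
  refine ⟨T, a, Q.X (a + 1), hT, hQ, ⟨{
    i := biprod.lift (Q.descOpcycles (s.f a ≫ inv (τ.f a) ≫ T.pOpcycles a) (a - 1) (by simp) ?_)
      (Q.fromOpcycles a (a + 1))
    r := biprod.desc (T.descOpcycles (τ.f a ≫ r.f a ≫ Q.pOpcycles a) (a - 1) (by simp) ?_)
      (-(h.hom (a + 1) a ≫ Q.pOpcycles a))
    retract := ?_ }⟩⟩
  · rw [← s.comm_assoc, reassoc_of% hinv, T.d_pOpcycles, comp_zero, comp_zero]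
  · simp [← τ.comm_assoc, ← r.comm_assoc]
  · rw [← cancel_epi (Q.pOpcycles a), biprod.lift_desc, Preadditive.comp_add,
      Q.p_descOpcycles_assoc, Category.assoc, Category.assoc, T.p_descOpcycles,
      IsIso.inv_hom_id_assoc, Q.p_fromOpcycles_assoc, h3]
    simp

end Comparison

/-! ### Splicing stages into a complex over `Q` -/

/-- A projective module over `Q.X j` together with a quotient over `Q.X (j + 1)`. -/
structure Stage (Q : CochainComplex (ModuleCat.{v} R) ℤ) (a j : ℤ) where
  P : ModuleCat.{v} R
  A : ModuleCat.{v} R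
  π : P ⟶ A
  t : P ⟶ Q.X j
  t' : A ⟶ Q.X (j + 1)
  projective : Projective P
  epi : Epi π
  comm : π ≫ t' = t ≫ Q.d j (j + 1)
  isDingSummand : a ≤ j → IsDingSummand A

/-- A monomorphism compatible with two consecutive stages, with the expected cokernel. -/
structure Stage.IsLink {Q : CochainComplex (ModuleCat.{v} R) ℤ} {a j : ℤ} (S : Stage Q a j)
    (S' : Stage Q a (j + 1)) (κ : S.A ⟶ S'.P) : Prop where
  mono : Mono κ
  zero : κ ≫ S'.π = 0
  exact : (ShortComplex.mk κ S'.π zero).Exact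
  flatExtending : FlatExtending κ
  comm : κ ≫ S'.t = S.t'

theorem Stage.exists_succ [Small.{v} R] {Q : CochainComplex (ModuleCat.{v} R) ℤ} {a j : ℤ}
    (hQ : ∀ n, Projective (Q.X n)) (S : Stage Q a j) (hj : a ≤ j) :
    ∃ (S' : Stage Q a (j + 1)) (κ : S.A ⟶ S'.P), S.IsLink S' κ := by
  obtain ⟨W, κ, hW, hκ, hκF, hA⟩ := (S.isDingSummand hj).exists_embedding
  have := hQ (j + 1)
  have := S.epi
  obtain ⟨t, ht⟩ := hκF _ (isFlat_of_categoryProjective (Q.X (j + 1))) S.t'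
  have h0 : κ ≫ t ≫ Q.d (j + 1) (j + 1 + 1) = 0 := by
    rw [← cancel_epi S.π, reassoc_of% ht, reassoc_of% S.comm, Q.d_comp_d, comp_zero, comp_zero]
  exact ⟨⟨W, cokernel κ, cokernel.π κ, t, cokernel.desc κ _ h0, hW, inferInstance, by simp,
    fun _ => hA⟩, κ, hκ, cokernel.condition κ,
    ShortComplex.exact_of_g_is_cokernel _ (cokernelIsCokernel κ), hκF, ht⟩

/-- The stage given by the complex itself. -/
noncomputable def Stage.self (Q : CochainComplex (ModuleCat.{v} R) ℤ) (a j : ℤ)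
    (hQ : ∀ n, Projective (Q.X n)) (h : a ≤ j → IsDingSummand (Q.opcycles j)) : Stage Q a j :=
  ⟨Q.X j, Q.opcycles j, Q.pOpcycles j, 𝟙 _, Q.fromOpcycles j (j + 1), hQ j, inferInstance,
    by simp, h⟩

theorem Stage.isLink_self {Q : CochainComplex (ModuleCat.{v} R) ℤ} {a j : ℤ}
    (hQ : ∀ n, Projective (Q.X n)) (h : a ≤ j → IsDingSummand (Q.opcycles j))
    (h' : a ≤ j + 1 → IsDingSummand (Q.opcycles (j + 1))) (hex : Q.ExactAt j)
    (hext : ∀ (F : ModuleCat.{v} R), IsFlat R F → ∀ f : Q.X j ⟶ F, Q.d (j - 1) j ≫ f = 0 →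
      ∃ g : Q.X (j + 1) ⟶ F, Q.d j (j + 1) ≫ g = f) :
    (Stage.self Q a j hQ h).IsLink (Stage.self Q a (j + 1) hQ h') (Q.fromOpcycles j (j + 1)) := by
  have h0 : Q.fromOpcycles j (j + 1) ≫ Q.pOpcycles (j + 1) = 0 := by
    rw [← cancel_epi (Q.pOpcycles j), Q.p_fromOpcycles_assoc, Q.d_pOpcycles, comp_zero]
  refine ⟨mono_fromOpcycles Q j hex, h0, ?_, ?_, ?_⟩
  · refine (ShortComplex.exact_iff_of_epi_of_isIso_of_mono (S₁ := ShortComplex.mk (Q.d j (j + 1))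
      (Q.pOpcycles (j + 1)) (Q.d_pOpcycles _ _)) (S₂ := ShortComplex.mk _ _ h0)
      { τ₁ := Q.pOpcycles j, τ₂ := 𝟙 _, τ₃ := 𝟙 _ }).1 ?_
    exact ShortComplex.exact_of_g_is_cokernel _ (Q.opcyclesIsCokernel j (j + 1) (by simp))
  · change FlatExtending (Q.fromOpcycles j (j + 1))
    intro F hF g
    obtain ⟨g', hg'⟩ := hext F hF (Q.pOpcycles j ≫ g) (by simp)
    refine ⟨g', ?_⟩
    rwa [← Q.p_fromOpcycles, Category.assoc, cancel_epi] at hg'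
  · exact Category.comp_id _

section Glue

variable {Q : CochainComplex (ModuleCat.{v} R) ℤ} {a : ℤ} (S : ∀ j, Stage Q a j)
  (κ : ∀ j, (S j).A ⟶ (S (j + 1)).P) (h : ∀ j, (S j).IsLink (S (j + 1)) (κ j))

/-- The complex obtained by splicing linked stages. -/
noncomputable def Stage.splice : CochainComplex (ModuleCat.{v} R) ℤ :=
  CochainComplex.of (fun j => (S j).P) (fun j => (S j).π ≫ κ j) fun j => by
    rw [Category.assoc, reassoc_of% (h j).zero, zero_comp, comp_zero]

theorem Stage.splice_d (j : ℤ) : (Stage.splice S κ h).d j (j + 1) = (S j).π ≫ κ j := by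
  simp [Stage.splice]

/-- The map from the splice of linked stages to the complex. -/
noncomputable def Stage.fromSplice : Stage.splice S κ h ⟶ Q where
  f j := (S j).t
  comm' i j hij := by
    obtain rfl : i + 1 = j := hij
    have h1 : (S i).t ≫ Q.d i (i + 1) = ((S i).π ≫ κ i) ≫ (S (i + 1)).t := by
      rw [Category.assoc, (h i).comm, (S i).comm]
    exact h1.trans (congrArg (· ≫ (S (i + 1)).t) (Stage.splice_d S κ h i).symm)

/-- For the `Hom` condition, a map killed by the incoming differential factors through the next
quotient and then extends along the next `κ`. -/
theorem Stage.isTotallyFAcyclic_splice [Small.{v} R] : IsTotallyFAcyclic (Stage.splice S κ h) := by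
  refine isTotallyFAcyclic_of_exists_extension (fun n => (S n).projective) ?_ ?_
  · intro j
    obtain ⟨i, rfl⟩ : ∃ i, j = i + 1 := ⟨j - 1, by lia⟩
    rw [HomologicalComplex.exactAt_iff' _ i (i + 1) (i + 1 + 1) (by simp) (by simp)]
    have := (S i).epi
    have := (h (i + 1)).mono
    have h1 : κ i ≫ (S (i + 1)).π ≫ κ (i + 1) = 0 := by
      rw [reassoc_of% (h i).zero, zero_comp]
    have h2 : ((S i).π ≫ κ i) ≫ (S (i + 1)).π ≫ κ (i + 1) = 0 := by
      rw [Category.assoc, h1, comp_zero]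
    have h3 : (ShortComplex.mk _ _ h1).Exact :=
      (ShortComplex.exact_iff_of_epi_of_isIso_of_mono (S₁ := ShortComplex.mk _ _ (h i).zero)
        (S₂ := ShortComplex.mk _ _ h1) { τ₁ := 𝟙 _, τ₂ := 𝟙 _, τ₃ := κ (i + 1) }).1 (h i).exact
    have h4 : (ShortComplex.mk _ _ h2).Exact :=
      (ShortComplex.exact_iff_of_epi_of_isIso_of_mono (S₁ := ShortComplex.mk _ _ h2)
        (S₂ := ShortComplex.mk _ _ h1) { τ₁ := (S i).π, τ₂ := 𝟙 _, τ₃ := 𝟙 _ }).2 h3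
    exact (ShortComplex.exact_iff_of_iso (ShortComplex.isoMk (S₁ := ShortComplex.mk _ _ h2)
      (S₂ := (Stage.splice S κ h).sc' i (i + 1) (i + 1 + 1)) (Iso.refl _) (Iso.refl _) (Iso.refl _)
      ((Category.id_comp _).trans ((Stage.splice_d S κ h i).trans (Category.comp_id _).symm))
      ((Category.id_comp _).trans
        ((Stage.splice_d S κ h (i + 1)).trans (Category.comp_id _).symm)))).1 h4
  · rintro F hF i j k rfl rfl f hf
    have := (S i).epi
    have := (S (i + 1)).epi
    have key : ∀ f : (S (i + 1)).P ⟶ F, ((S i).π ≫ κ i) ≫ f = 0 →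
        ∃ g : (S (i + 1 + 1)).P ⟶ F, ((S (i + 1)).π ≫ κ (i + 1)) ≫ g = f := by
      intro f hf
      rw [Category.assoc, ← comp_zero (f := (S i).π), cancel_epi] at hf
      obtain ⟨g, hg⟩ := (h (i + 1)).flatExtending F hF ((h i).exact.desc f hf)
      exact ⟨g, by rw [Category.assoc, hg]; exact (h i).exact.g_desc f hf⟩
    obtain ⟨g, hg⟩ := key f ((congrArg (· ≫ f) (Stage.splice_d S κ h i)).symm.trans hf)
    exact ⟨g, (congrArg (· ≫ g) (Stage.splice_d S κ h (i + 1))).trans hg⟩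

end Glue

variable [Small.{v} R]

/-- If `Q` is a homotopy retract of `P`, and `T ⟶ P` is an isomorphism in cohomological degrees at
most `a` with `T` totally `ℱ`-acyclic, then `Q` has a morphism with these properties as well. -/
theorem exists_totallyFAcyclic_of_homotopyRetract {T P Q : CochainComplex (ModuleCat.{v} R) ℤ}
    {τ : T ⟶ P} {a : ℤ} {s : Q ⟶ P} {r : P ⟶ Q} (hT : IsTotallyFAcyclic T)
    (hQ : ∀ n, Projective (Q.X n)) (hτ : ∀ j ≤ a, IsIso (τ.f j)) (h : Homotopy (s ≫ r) (𝟙 Q)) :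
    ∃ (T' : CochainComplex (ModuleCat.{v} R) ℤ) (τ' : T' ⟶ Q), IsTotallyFAcyclic T' ∧
      ∀ j ≤ a, IsIso (τ'.f j) := by
  have hA : ∀ j ≤ a, a ≤ j → IsDingSummand (Q.opcycles j) := fun j hj hj' => by
    obtain rfl := le_antisymm hj hj'
    exact isDingSummand_of_retract hT (hQ _) hτ h
  choose next κ hκ using fun (j : ℤ) (hj : a ≤ j) (S : Stage Q a j) => S.exists_succ hQ hj
  -- Up to and including `a` the stages are those of `Q`, so the comparison map is the identity
  -- there; above `a` they come from repeated embeddings.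
  let S : ∀ j, Stage Q a j := fun j => Int.inductionOn' (motive := Stage Q a) j a
    (Stage.self Q a a hQ (hA a le_rfl)) (fun j hj S => next j hj S)
    (fun j hj _ => Stage.self Q a (j - 1) hQ (hA _ (by lia)))
  have hself : ∀ j (hj : j ≤ a), S j = Stage.self Q a j hQ (hA j hj) := fun j hj => by
    obtain rfl | hj' := hj.eq_or_lt
    · exact Int.inductionOn'_self
    · obtain ⟨j, rfl⟩ : ∃ i, j = i - 1 := ⟨j + 1, by lia⟩
      exact Int.inductionOn'_sub_one (by lia)
  have hlink : ∀ j, ∃ κ, (S j).IsLink (S (j + 1)) κ := fun j => by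
    by_cases hj : a ≤ j
    · have h1 : S (j + 1) = next j hj (S j) := Int.inductionOn'_add_one hj
      rw [h1]
      exact ⟨_, hκ j hj (S j)⟩
    · rw [hself j (by lia), hself (j + 1) (by lia)]
      exact ⟨_, Stage.isLink_self hQ _ _ (exactAt_of_retract hT.acyclic hτ h j (by lia))
        fun F hF f hf => exists_extension_of_retract hT hτ h hF (sub_add_cancel j 1) rfl
          (by lia) f hf⟩
  choose κ' hκ' using hlink
  refine ⟨Stage.splice S κ' hκ', Stage.fromSplice S κ' hκ', Stage.isTotallyFAcyclic_splice S κ' hκ',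
    fun j hj => ?_⟩
  change IsIso (S j).t
  rw [hself j hj]
  exact IsIso.id _

end DingDim

/-! ### Complete resolutions and the dimension -/

namespace DingDim

variable {R : Type u} [Ring R]

theorem bijective_iff_isIso {M N : ModuleCat.{v} R} (f : M ⟶ N) :
    Function.Bijective f ↔ IsIso f :=
  (ConcreteCategory.isIso_iff_bijective f).symm

/-- There is an `ℱ`-complete resolution of `X` with `τ` bijective in homological degrees at least
`n`. -/
def HasFCompleteResolutionFrom (X : CochainComplex (ModuleCat.{v} R) ℤ) (n : ℤ) : Prop :=
  ∃ D : FCompleteResolution X, ∀ i : ℤ, n ≤ i → Function.Bijective (D.τ.f (-i))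

theorem HasFCompleteResolutionFrom.mono {X : CochainComplex (ModuleCat.{v} R) ℤ} {m n : ℤ}
    (h : HasFCompleteResolutionFrom X m) (hmn : m ≤ n) : HasFCompleteResolutionFrom X n := by
  obtain ⟨D, hD⟩ := h
  exact ⟨D, fun i hi => hD i (hmn.trans hi)⟩

theorem dpd_le_coe_iff (X : CochainComplex (ModuleCat.{v} R) ℤ) (n : ℤ) :
    dpd X ≤ (n : EInt) ↔ HasFCompleteResolutionFrom X n := by
  refine ⟨fun h => ?_, fun h => sInf_le ⟨n, rfl, h⟩⟩
  by_contra hn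
  have h1 : ((n + 1 : ℤ) : EInt) ≤ dpd X := by
    refine le_sInf ?_
    rintro _ ⟨m, rfl, hm⟩
    rw [WithBotTop.coe_le_coe]
    by_contra hmn
    exact hn (HasFCompleteResolutionFrom.mono hm (by lia))
  have h2 := h1.trans h
  rw [WithBotTop.coe_le_coe] at h2
  lia

theorem eint_le_of_forall_coe {x y : EInt} (h : ∀ n : ℤ, y ≤ (n : EInt) → x ≤ (n : EInt)) :
    x ≤ y := by
  induction y using WithBotTop.rec with
  | bot =>
    induction x using WithBotTop.rec with
    | bot => exact le_rfl
    | coe m =>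
      -- When `y` is `⊥`, every integer bounds `x`, so `m - 1` excludes `x = m`.
      have h1 := h (m - 1) bot_le
      rw [WithBotTop.coe_le_coe] at h1
      lia
    | top => exact absurd (top_le_iff.1 (h 0 bot_le)) (WithBotTop.coe_ne_top _)
  | coe m => exact h m le_rfl
  | top => exact le_top

variable [Small.{v} R]

theorem hasFCompleteResolutionFrom_sigma {I : Type v} {X : I → CochainComplex (ModuleCat.{v} R) ℤ}
    {n : ℤ} (h : ∀ i, HasFCompleteResolutionFrom (X i) n) :
    HasFCompleteResolutionFrom (∐ X) n := by
  choose D hD using h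
  have key : ∀ j : ℤ, n ≤ j →
      Function.Bijective ((Limits.Sigma.map fun i => (D i).τ).f (-j)) := fun j hj => by
    rw [bijective_iff_isIso]
    exact HomologicalComplex.isIso_sigmaMap_f _ _ fun i => (bijective_iff_isIso _).1 (hD i j hj)
  exact ⟨{
    T := ∐ fun i => (D i).T
    P := ∐ fun i => (D i).P
    τ := Limits.Sigma.map fun i => (D i).τ
    π := Limits.Sigma.map fun i => (D i).π
    totallyFAcyclic := IsTotallyFAcyclic.sigma fun i => (D i).totallyFAcyclic
    dgProjective := IsDGProjective.sigma fun i => (D i).dgProjective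
    quasiIso := HomologicalComplex.quasiIso_sigmaMap _ fun i => (D i).quasiIso
    eventually_bijective := ⟨n, key⟩ }, key⟩

theorem HasFCompleteResolutionFrom.of_retract {X Y : CochainComplex (ModuleCat.{v} R) ℤ} {n : ℤ}
    (h : HasFCompleteResolutionFrom X n) (e : Retract Y X) : HasFCompleteResolutionFrom Y n := by
  obtain ⟨D, hD⟩ := h
  have := D.quasiIso
  have := D.dgProjective.isKProjective
  obtain ⟨Q, π, hQ, hπ⟩ := exists_dgProjective_of_retract e D.dgProjective D.π D.quasiIso
  have := hQ.isKProjective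
  obtain ⟨s, ⟨hs⟩⟩ := CochainComplex.IsKProjective.exists_lift D.π (π ≫ e.i)
  obtain ⟨r, ⟨hr⟩⟩ := CochainComplex.IsKProjective.exists_lift π (D.π ≫ e.r)
  -- After composition with `π`, `s ≫ r` becomes `π ≫ e.i ≫ e.r = π` up to homotopy, and `π` can be
  -- cancelled up to homotopy.
  obtain ⟨H⟩ := CochainComplex.IsKProjective.nonempty_homotopy π (s ≫ r) (𝟙 Q) <|
    (Homotopy.ofEq (Category.assoc _ _ _)).trans <| (hr.compLeft s).trans <|
      (Homotopy.ofEq (Category.assoc _ _ _).symm).trans <| (hs.compRight e.r).trans <|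
        Homotopy.ofEq (by simp)
  obtain ⟨T, τ, hT, hτ⟩ := exists_totallyFAcyclic_of_homotopyRetract (a := -n) D.totallyFAcyclic
    hQ.projective_X (fun j hj => by
      obtain ⟨i, rfl⟩ : ∃ i, j = -i := ⟨-j, by lia⟩
      exact (bijective_iff_isIso _).1 (hD i (by lia))) H
  have key : ∀ i : ℤ, n ≤ i → Function.Bijective (τ.f (-i)) := fun i hi =>
    (bijective_iff_isIso _).2 (hτ (-i) (by lia))
  exact ⟨⟨T, Q, τ, π, hT, hQ, hπ, n, key⟩, key⟩

theorem hasFCompleteResolutionFrom_sigma_iff {I : Type v}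
    (X : I → CochainComplex (ModuleCat.{v} R) ℤ) (n : ℤ) :
    HasFCompleteResolutionFrom (∐ X) n ↔ ∀ i, HasFCompleteResolutionFrom (X i) n := by
  classical
  exact ⟨fun h i => h.of_retract ⟨Sigma.ι X i, Sigma.π X i, Sigma.ι_π_eq_id X i⟩,
    hasFCompleteResolutionFrom_sigma⟩

end DingDim

theorem mainTheorem7 {R : Type u} [Ring R] [Small.{v} R] {I : Type v}
    (X : I → CochainComplex (ModuleCat.{v} R) ℤ) :
    DingDim.dpd (∐ X) = ⨆ i, DingDim.dpd (X i) := by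
  have h : ∀ n : ℤ, DingDim.dpd (∐ X) ≤ (n : EInt) ↔ ⨆ i, DingDim.dpd (X i) ≤ (n : EInt) :=
    fun n => by
      rw [DingDim.dpd_le_coe_iff, DingDim.hasFCompleteResolutionFrom_sigma_iff, iSup_le_iff]
      exact forall_congr' fun i => (DingDim.dpd_le_coe_iff _ _).symm
  exact le_antisymm (DingDim.eint_le_of_forall_coe fun n => (h n).2)
    (DingDim.eint_le_of_forall_coe fun n => (h n).1)
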